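/- Let $(M,d)$ be a complete separable metric space, let $\mu_n$ ($n\in\mathbb N$) and $\mu$ be Borel probability measures on $M$, and let $c(x,y)=C(d(x,y))$, where $C:[0,\infty)\to[0,\infty)$ is non-decreasing and continuous with $C(0)=0$. Let $$T_c(\mu,\nu)=\inf_{\pi}\int_{M\times M} c(x,y)\,d\pi(x,y),$$ where the infimum is over all probability measures $\pi$ on $M\times M$ with marginals $\mu$ and $\nu$, and let $\Longrightarrow$ denote weak convergence of probability measures. Let $a\in M$ be such that $\int C(2d(x,a))\,\mu_n(dx)<\infty$ for all $n$ and $\int C(2d(x,a))\,\mu(dx)<\infty$. Then: 1. If (a) $\mu_n\Longrightarrow\mu$ and (b) $\int C(2d(x,a))\,\mu_n(dx)\to\int C(2d(x,a))\,\mu(dx)$, then $T_c(\mu_n,\mu)\to0$. 2. Conversely, if $C(t)>0$ for all $t>0$ and $T_c(\mu_n,\mu)\to0$, then $\mu_n\Longrightarrow\mu$. 3. Suppose that $C$ is not identically zero and that there is a constant $\lambda>0$ with $C(2y)\le\lambda C(y)$ for all $y\ge0$. Then, for every $b\in M$, the integrals $\int C(2d(x,b))\,\mu_n(dx)$ and $\int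 C(2d(x,b))\,\mu(dx)$ are finite, and $T_c(\mu_n,\mu)\to0$ if and only if both $\mu_n\Longrightarrow\mu$ and $\int C(2d(x,b))\,\mu_n(dx)\to\int C(2d(x,b))\,\mu(dx)$. -/

import Mathlib

open MeasureTheory Filter Topology
open scoped NNReal ENNReal

/-- `π` is a joint distribution on `M × M` with first marginal `μ` and second marginal `ν`.
It is automatically a probability measure when `μ` is one. -/
def IsCoupling {M : Type*} [MeasurableSpace M] (π : Measure (M × M)) (μ ν : Measure M) : Prop :=
  π.map Prod.fst = μ ∧ π.map Prod.snd = ν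

/-- The transportation distance `T_c(μ, ν)`: the infimum of the total cost `∫ c(x, y) dπ(x, y)`
over all joint distributions `π` with marginals `μ` and `ν`, with values in `[0, ∞]`. -/
noncomputable def transportDist {M : Type*} [MeasurableSpace M] (c : M → M → ℝ≥0)
    (μ ν : Measure M) : ℝ≥0∞ :=
  ⨅ (π : Measure (M × M)) (_ : IsCoupling π μ ν), ∫⁻ p, (c p.1 p.2 : ℝ≥0∞) ∂π

/-- The moment `∫ C(2 d(x, a)) μ(dx)`, with values in `[0, ∞]`. -/
noncomputable def doubleMoment {M : Type*} [MetricSpace M] [MeasurableSpace M] (C : ℝ≥0 → ℝ≥0)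
    (a : M) (μ : Measure M) : ℝ≥0∞ :=
  ∫⁻ x, (C (2 * nndist x a) : ℝ≥0∞) ∂μ

/-! ### Truncation of moments. -/

section Truncation

variable {M : Type*} [MeasurableSpace M]

/-! Weak convergence gives `T_c` convergence by an explicit coupling. Cut `M` into small
`μ`-continuity sets and match, inside each of finitely many, as much mass as possible. This costs
little, and by the portmanteau theorem the unmatched mass becomes small. The rest is coupled
arbitrarily. With `g x = C (2 d(x, a))`, its cost is at most `g x + g y`, and convergence of moments
makes the tails `(g - R)⁺` small along the sequence.

Conversely, Markov's inequality bounds the mass that a coupling moves by `η` or more, which yields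
the closed-set portmanteau criterion. Under doubling, `C` is positive off `0`, and the tails for `μs
n` are controlled by those for `μ` plus a multiple of `T_c`, so the moments converge. -/

lemma lintegral_min_le (μ : Measure M) [IsProbabilityMeasure μ] (g : M → ℝ≥0) (R : ℝ≥0) :
    ∫⁻ x, ((min (g x) R : ℝ≥0) : ℝ≥0∞) ∂μ ≤ R := by
  calc _ ≤ ∫⁻ _, (R : ℝ≥0∞) ∂μ := lintegral_mono fun x => ENNReal.coe_le_coe.2 (min_le_right _ _)
    _ = R := by simp

lemma lintegral_min_add_lintegral_tsub (μ : Measure M) {g : M → ℝ≥0} (hg : Measurable g)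
    (R : ℝ≥0) :
    ∫⁻ x, ((min (g x) R : ℝ≥0) : ℝ≥0∞) ∂μ + ∫⁻ x, ((g x - R : ℝ≥0) : ℝ≥0∞) ∂μ =
      ∫⁻ x, g x ∂μ := by
  rw [← lintegral_add_left (by fun_prop)]
  refine lintegral_congr fun x => ?_
  rw [← ENNReal.coe_add, add_comm, tsub_add_min]

lemma tendsto_lintegral_tsub_atTop (μ : Measure M) {g : M → ℝ≥0} (hg : Measurable g)
    (hfin : ∫⁻ x, g x ∂μ ≠ ∞) :
    Tendsto (fun R : ℕ => ∫⁻ x, ((g x - R : ℝ≥0) : ℝ≥0∞) ∂μ) atTop (𝓝 0) := by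
  have := tendsto_lintegral_of_dominated_convergence (μ := μ)
    (F := fun (R : ℕ) x => ((g x - R : ℝ≥0) : ℝ≥0∞)) (f := fun _ => 0) (fun x => (g x : ℝ≥0∞))
    (fun R => by fun_prop)
    (fun R => .of_forall fun x => ENNReal.coe_le_coe.2 tsub_le_self) hfin
    (.of_forall fun x => by
      obtain ⟨N, hN⟩ := exists_nat_ge (g x)
      refine tendsto_const_nhds.congr' ?_
      filter_upwards [eventually_ge_atTop N] with R hR
      have : g x ≤ R := hN.trans (by exact_mod_cast hR)
      simp [tsub_eq_zero_of_le this])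
  simpa using this

/-- Used for the unmatched part `α` of `μ`: its small mass handles `g` up to level `R`, the tail of
`μ` handles the rest. -/
lemma lintegral_le_mul_add_lintegral_tsub {α μ : Measure M} (h : α ≤ μ) {g : M → ℝ≥0} (R : ℝ≥0) :
    ∫⁻ x, g x ∂α ≤ R * α Set.univ + ∫⁻ x, ((g x - R : ℝ≥0) : ℝ≥0∞) ∂μ := by
  calc ∫⁻ x, (g x : ℝ≥0∞) ∂α ≤ ∫⁻ x, ((R : ℝ≥0∞) + ((g x - R : ℝ≥0) : ℝ≥0∞)) ∂α :=
        lintegral_mono fun x => by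
          rw [← ENNReal.coe_add]
          exact ENNReal.coe_le_coe.2 le_add_tsub
    _ = R * α Set.univ + ∫⁻ x, ((g x - R : ℝ≥0) : ℝ≥0∞) ∂α := by
        rw [lintegral_add_left measurable_const, lintegral_const]
    _ ≤ _ := by gcongr

end Truncation

/-! ### Block couplings and the cost of the remainder. -/

section Coupling

variable {M : Type*} [MeasurableSpace M]

lemma isFiniteMeasure_of_map_fst_le {γ : Measure (M × M)} {μ : Measure M} [IsFiniteMeasure μ]
    (h : γ.map Prod.fst ≤ μ) : IsFiniteMeasure γ := by
  refine ⟨?_⟩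
  calc γ Set.univ = γ.map Prod.fst Set.univ := by
        rw [Measure.map_apply measurable_fst .univ, Set.preimage_univ]
    _ ≤ μ Set.univ := h _
    _ < ∞ := measure_lt_top _ _

lemma measure_sub_map_univ {γ : Measure (M × M)} [IsFiniteMeasure γ] {μ : Measure M}
    [IsProbabilityMeasure μ] {f : M × M → M} (hf : Measurable f) (h : γ.map f ≤ μ) :
    (μ - γ.map f) Set.univ = 1 - γ Set.univ := by
  rw [Measure.sub_apply .univ h, Measure.map_apply hf .univ, Set.preimage_univ, measure_univ]

/-- A sub-coupling extends to a coupling, by adding a multiple of the product of the remainders. -/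
lemma transportDist_le_of_subcoupling {μ ν : Measure M} [IsProbabilityMeasure μ]
    [IsProbabilityMeasure ν] {c : M → M → ℝ≥0} {g : M → ℝ≥0} (hg : Measurable g)
    (hcg : ∀ x y, c x y ≤ g x + g y) {γ : Measure (M × M)}
    (h₁ : γ.map Prod.fst ≤ μ) (h₂ : γ.map Prod.snd ≤ ν) :
    transportDist c μ ν ≤ ∫⁻ p, c p.1 p.2 ∂γ +
      (∫⁻ x, g x ∂(μ - γ.map Prod.fst) + ∫⁻ x, g x ∂(ν - γ.map Prod.snd)) := by
  have := isFiniteMeasure_of_map_fst_le h₁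
  set α := μ - γ.map Prod.fst with hα
  set β := ν - γ.map Prod.snd with hβ
  have hα1 : α Set.univ = 1 - γ Set.univ := measure_sub_map_univ measurable_fst h₁
  have hβ1 : β Set.univ = 1 - γ Set.univ := measure_sub_map_univ measurable_snd h₂
  set s := 1 - γ Set.univ with hs
  have hs_top : s ≠ ∞ := ne_top_of_le_ne_top ENNReal.one_ne_top tsub_le_self
  have : IsFiniteMeasure α := ⟨by rw [hα1]; exact hs_top.lt_top⟩
  have : IsFiniteMeasure β := ⟨by rw [hβ1]; exact hs_top.lt_top⟩
  have cancel : ∀ δ : Measure M, δ Set.univ = s → s⁻¹ • s • δ = δ := by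
    intro δ hδ
    by_cases h0 : s = 0
    -- Here `s⁻¹ = ∞`, but the remainder is the zero measure.
    · rw [h0] at hδ
      simp [Measure.measure_univ_eq_zero.1 hδ]
    · rw [smul_smul, ENNReal.inv_mul_cancel h0 hs_top, one_smul]
  have map₁ : (s⁻¹ • α.prod β).map Prod.fst = α := by
    rw [Measure.map_smul, Measure.map_fst_prod, hβ1, cancel α hα1]
  have map₂ : (s⁻¹ • α.prod β).map Prod.snd = β := by
    rw [Measure.map_smul, Measure.map_snd_prod, hα1, cancel β hβ1]
  have hπ : IsCoupling (γ + s⁻¹ • α.prod β) μ ν := by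
    constructor
    · rw [Measure.map_add _ _ measurable_fst, map₁, add_comm, hα,
        Measure.sub_add_cancel_of_le h₁]
    · rw [Measure.map_add _ _ measurable_snd, map₂, add_comm, hβ,
        Measure.sub_add_cancel_of_le h₂]
  refine iInf_le_of_le _ (iInf_le_of_le hπ ?_)
  rw [lintegral_add_measure]
  gcongr
  have hg' : Measurable fun x => (g x : ℝ≥0∞) := hg.coe_nnreal_ennreal
  calc ∫⁻ p, (c p.1 p.2 : ℝ≥0∞) ∂(s⁻¹ • α.prod β)
      ≤ ∫⁻ p, ((g p.1 : ℝ≥0∞) + g p.2) ∂(s⁻¹ • α.prod β) :=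
        lintegral_mono fun p => by
          rw [← ENNReal.coe_add]
          exact ENNReal.coe_le_coe.2 (hcg p.1 p.2)
    _ = ∫⁻ x, g x ∂((s⁻¹ • α.prod β).map Prod.fst) +
        ∫⁻ x, g x ∂((s⁻¹ • α.prod β).map Prod.snd) := by
        rw [lintegral_add_left (by fun_prop), lintegral_map hg' measurable_fst,
          lintegral_map hg' measurable_snd]
    _ = _ := by rw [map₁, map₂]

/-- The block coupling that matches, on each of finitely many disjoint sets, as much mass of `μ`
and `ν` as possible. -/
noncomputable def blockCoupling (μ ν : Measure M) (B : ℕ → Set M) (k : ℕ) : Measure (M × M) :=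
  ∑ i ∈ Finset.range k,
    (max (μ (B i)) (ν (B i)))⁻¹ • (μ.restrict (B i)).prod (ν.restrict (B i))

variable {B : ℕ → Set M}

lemma sum_restrict_le (μ : Measure M) (hB : ∀ i, MeasurableSet (B i))
    (hd : Pairwise (Function.onFun Disjoint B)) (k : ℕ) :
    ∑ i ∈ Finset.range k, μ.restrict (B i) ≤ μ := by
  refine Measure.le_iff.2 fun s hs => ?_
  rw [Measure.finsetSum_apply]
  simp_rw [Measure.restrict_apply hs]
  rw [← measure_biUnion_finset
    (fun i _ j _ hij => (hd hij).mono Set.inter_subset_right Set.inter_subset_right)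
    (fun i _ => hs.inter (hB i))]
  exact measure_mono (Set.iUnion₂_subset fun i _ => Set.inter_subset_left)

/-- On block `i` the marginal is `μ` restricted, scaled by `ν (B i) / max (μ (B i)) (ν (B i)) ≤ 1`.
-/
lemma map_fst_blockCoupling_le (μ ν : Measure M) [IsFiniteMeasure μ] [IsFiniteMeasure ν]
    (hB : ∀ i, MeasurableSet (B i)) (hd : Pairwise (Function.onFun Disjoint B)) (k : ℕ) :
    (blockCoupling μ ν B k).map Prod.fst ≤ μ := by
  refine le_trans ?_ (sum_restrict_le μ hB hd k)
  rw [blockCoupling, Measure.map_finset_sum measurable_fst.aemeasurable]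
  refine Finset.sum_le_sum fun i _ => ?_
  rw [Measure.map_smul, Measure.map_fst_prod, smul_smul, Measure.restrict_apply_univ]
  refine Measure.le_iff.2 fun s _ => ?_
  rw [Measure.smul_apply, smul_eq_mul]
  refine mul_le_of_le_one_left' ?_
  rw [mul_comm, ← div_eq_mul_inv]
  exact ENNReal.div_le_of_le_mul (by rw [one_mul]; exact le_max_right _ _)

lemma map_snd_blockCoupling_le (μ ν : Measure M) [IsFiniteMeasure μ] [IsFiniteMeasure ν]
    (hB : ∀ i, MeasurableSet (B i)) (hd : Pairwise (Function.onFun Disjoint B)) (k : ℕ) :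
    (blockCoupling μ ν B k).map Prod.snd ≤ ν := by
  refine le_trans ?_ (sum_restrict_le ν hB hd k)
  rw [blockCoupling, Measure.map_finset_sum measurable_snd.aemeasurable]
  refine Finset.sum_le_sum fun i _ => ?_
  rw [Measure.map_smul, Measure.map_snd_prod, smul_smul, Measure.restrict_apply_univ]
  refine Measure.le_iff.2 fun s _ => ?_
  rw [Measure.smul_apply, smul_eq_mul]
  refine mul_le_of_le_one_left' ?_
  rw [mul_comm, ← div_eq_mul_inv]
  exact ENNReal.div_le_of_le_mul (by rw [one_mul]; exact le_max_left _ _)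

/-- Each block has mass `μ (B i) * ν (B i) / max`, and a product divided by the maximum is the
minimum. -/
lemma blockCoupling_univ (μ ν : Measure M) [IsFiniteMeasure μ] [IsFiniteMeasure ν] (k : ℕ) :
    blockCoupling μ ν B k Set.univ = ∑ i ∈ Finset.range k, min (μ (B i)) (ν (B i)) := by
  rw [blockCoupling, Measure.finsetSum_apply]
  refine Finset.sum_congr rfl fun i _ => ?_
  rw [Measure.smul_apply, ← Set.univ_prod_univ, Measure.prod_prod, Measure.restrict_apply_univ,
    Measure.restrict_apply_univ, smul_eq_mul, ← max_mul_min (μ (B i)) (ν (B i)), ← mul_assoc]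
  by_cases h : max (μ (B i)) (ν (B i)) = 0
  · have : min (μ (B i)) (ν (B i)) = 0 := le_antisymm (min_le_max.trans h.le) zero_le
    simp [this]
  · rw [ENNReal.inv_mul_cancel h (by simp), one_mul]

lemma lintegral_blockCoupling_le {μ ν : Measure M} [IsProbabilityMeasure μ] [IsFiniteMeasure ν]
    (hB : ∀ i, MeasurableSet (B i)) (hd : Pairwise (Function.onFun Disjoint B)) (k : ℕ)
    {c : M → M → ℝ≥0} {r : ℝ≥0} (hr : ∀ i, ∀ x ∈ B i, ∀ y ∈ B i, c x y ≤ r) :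
    ∫⁻ p, c p.1 p.2 ∂(blockCoupling μ ν B k) ≤ r := by
  have h1 : blockCoupling μ ν B k Set.univ ≤ 1 := by
    calc _ = (blockCoupling μ ν B k).map Prod.fst Set.univ := by
          rw [Measure.map_apply measurable_fst .univ, Set.preimage_univ]
      _ ≤ μ Set.univ := map_fst_blockCoupling_le μ ν hB hd k _
      _ = 1 := measure_univ
  have hae : ∀ᵐ p ∂(blockCoupling μ ν B k), (c p.1 p.2 : ℝ≥0∞) ≤ r := by
    rw [blockCoupling, ← Measure.sum_coe_finset, Measure.ae_sum_iff]
    rintro ⟨i, _⟩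
    refine Measure.ae_smul_measure ?_ _
    have a₁ := Measure.quasiMeasurePreserving_fst (μ := μ.restrict (B i))
      (ν := ν.restrict (B i)) |>.ae (ae_restrict_mem (hB i))
    have a₂ := Measure.quasiMeasurePreserving_snd (μ := μ.restrict (B i))
      (ν := ν.restrict (B i)) |>.ae (ae_restrict_mem (hB i))
    filter_upwards [a₁, a₂] with p h₁ h₂
    exact_mod_cast hr i _ h₁ _ h₂
  calc _ ≤ ∫⁻ _, (r : ℝ≥0∞) ∂(blockCoupling μ ν B k) := lintegral_mono_ae hae
    _ = r * blockCoupling μ ν B k Set.univ := lintegral_const _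
    _ ≤ r * 1 := by gcongr
    _ = r := mul_one _

lemma transportDist_le_of_blocks {μ ν : Measure M} [IsProbabilityMeasure μ]
    [IsProbabilityMeasure ν] {c : M → M → ℝ≥0} {g : M → ℝ≥0} (hg : Measurable g)
    (hcg : ∀ x y, c x y ≤ g x + g y)
    (hB : ∀ i, MeasurableSet (B i)) (hd : Pairwise (Function.onFun Disjoint B)) (k : ℕ)
    {r : ℝ≥0} (hr : ∀ i, ∀ x ∈ B i, ∀ y ∈ B i, c x y ≤ r) (R : ℝ≥0) :
    transportDist c μ ν ≤
      r + 2 * R * (1 - ∑ i ∈ Finset.range k, min (μ (B i)) (ν (B i))) +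
        (∫⁻ x, ((g x - R : ℝ≥0) : ℝ≥0∞) ∂μ + ∫⁻ x, ((g x - R : ℝ≥0) : ℝ≥0∞) ∂ν) := by
  have h₁ := map_fst_blockCoupling_le μ ν hB hd k
  have h₂ := map_snd_blockCoupling_le μ ν hB hd k
  have := isFiniteMeasure_of_map_fst_le h₁
  have b₁ := lintegral_le_mul_add_lintegral_tsub
    (Measure.sub_le (μ := μ) (ν := (blockCoupling μ ν B k).map Prod.fst)) (g := g) R
  have b₂ := lintegral_le_mul_add_lintegral_tsub
    (Measure.sub_le (μ := ν) (ν := (blockCoupling μ ν B k).map Prod.snd)) (g := g) R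
  rw [measure_sub_map_univ measurable_fst h₁, blockCoupling_univ] at b₁
  rw [measure_sub_map_univ measurable_snd h₂, blockCoupling_univ] at b₂
  refine (transportDist_le_of_subcoupling hg hcg h₁ h₂).trans
    ((add_le_add (lintegral_blockCoupling_le hB hd k hr) (add_le_add b₁ b₂)).trans_eq ?_)
  ring

end Coupling

/-! ### Continuity sets and weak convergence. -/

lemma measure_frontier_sdiff_eq_zero {M : Type*} [TopologicalSpace M] [MeasurableSpace M]
    {μ : Measure M} {s t : Set M} (hs : μ (frontier s) = 0)
    (ht : μ (frontier t) = 0) : μ (frontier (s \ t)) = 0 := by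
  refine measure_mono_null (t := frontier s ∪ frontier t) ?_ (measure_union_null hs ht)
  rw [Set.sdiff_eq]
  refine (frontier_inter_subset s tᶜ).trans (Set.union_subset_union Set.inter_subset_left ?_)
  rw [frontier_compl]
  exact Set.inter_subset_right

section Weak

variable {M : Type*} [MetricSpace M] [MeasurableSpace M] [BorelSpace M]

lemma tendsto_lintegral_min {μs : ℕ → ProbabilityMeasure M} {μ : ProbabilityMeasure M}
    (h : Tendsto μs atTop (𝓝 μ)) {g : M → ℝ≥0} (hg : Continuous g) (R : ℝ≥0) :
    Tendsto (fun n => ∫⁻ x, ((min (g x) R : ℝ≥0) : ℝ≥0∞) ∂(μs n : Measure M)) atTop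
      (𝓝 (∫⁻ x, ((min (g x) R : ℝ≥0) : ℝ≥0∞) ∂(μ : Measure M))) := by
  let f : BoundedContinuousFunction M ℝ≥0 := .mkOfBound ⟨fun x => min (g x) R, by fun_prop⟩ R
    fun x y => by
      have hx : ((min (g x) R : ℝ≥0) : ℝ) ≤ R := NNReal.coe_le_coe.2 (min_le_right _ _)
      have hy : ((min (g y) R : ℝ≥0) : ℝ) ≤ R := NNReal.coe_le_coe.2 (min_le_right _ _)
      have hx0 := (min (g x) R).coe_nonneg
      have hy0 := (min (g y) R).coe_nonneg
      simp only [ContinuousMap.coe_mk, NNReal.dist_eq]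
      rw [abs_le]
      constructor <;> linarith
  exact ProbabilityMeasure.tendsto_iff_forall_lintegral_tendsto.1 h f

/-- The truncation `min g R` is bounded and continuous, so its integrals converge; subtract them
from the convergent full integrals. -/
lemma tendsto_lintegral_tsub {μs : ℕ → ProbabilityMeasure M} {μ : ProbabilityMeasure M}
    (h : Tendsto μs atTop (𝓝 μ)) {g : M → ℝ≥0} (hg : Continuous g)
    (hlim : Tendsto (fun n => ∫⁻ x, g x ∂(μs n : Measure M)) atTop
      (𝓝 (∫⁻ x, g x ∂(μ : Measure M)))) (R : ℝ≥0) :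
    Tendsto (fun n => ∫⁻ x, ((g x - R : ℝ≥0) : ℝ≥0∞) ∂(μs n : Measure M)) atTop
      (𝓝 (∫⁻ x, ((g x - R : ℝ≥0) : ℝ≥0∞) ∂(μ : Measure M))) := by
  have key : ∀ ν : ProbabilityMeasure M, ∫⁻ x, ((g x - R : ℝ≥0) : ℝ≥0∞) ∂(ν : Measure M) =
      ∫⁻ x, g x ∂(ν : Measure M) - ∫⁻ x, ((min (g x) R : ℝ≥0) : ℝ≥0∞) ∂(ν : Measure M) := by
    intro ν
    rw [← lintegral_min_add_lintegral_tsub (ν : Measure M) hg.measurable R]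
    exact (ENNReal.add_sub_cancel_left
      (ne_top_of_le_ne_top ENNReal.coe_ne_top (lintegral_min_le _ g R))).symm
  simp_rw [key]
  exact ENNReal.Tendsto.sub hlim (tendsto_lintegral_min h hg R)
    (.inr (ne_top_of_le_ne_top ENNReal.coe_ne_top (lintegral_min_le _ g R)))

lemma exists_continuity_partition [TopologicalSpace.SeparableSpace M] (μ : Measure M)
    [IsProbabilityMeasure μ]
    {η : ℝ} (hη : 0 < η) :
    ∃ B : ℕ → Set M, (∀ i, MeasurableSet (B i)) ∧ Pairwise (Function.onFun Disjoint B) ∧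
      (∀ i, μ (frontier (B i)) = 0) ∧ (∀ i, ∀ x ∈ B i, ∀ y ∈ B i, dist x y < η) ∧
      ∑' i, μ (B i) = 1 := by
  have : Nonempty M := μ.nonempty_of_neZero
  have h4 : 0 < η / 2 := half_pos hη
  -- Radii lie in `(η / 4, η / 2)`: the lower bound lets balls at a dense sequence cover `M`, the
  -- upper keeps diameters below `η`.
  choose r hr hfr using fun i =>
    exists_null_frontier_thickening μ {TopologicalSpace.denseSeq M i} (half_lt_self h4)
  set f := fun i => Metric.thickening (r i) {TopologicalSpace.denseSeq M i} with hf
  have hcover : ⋃ i, f i = Set.univ := by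
    refine Set.eq_univ_of_forall fun x => ?_
    obtain ⟨i, hi⟩ := (TopologicalSpace.denseRange_denseSeq M).exists_dist_lt x (half_pos h4)
    refine Set.mem_iUnion.2 ⟨i, ?_⟩
    change x ∈ Metric.thickening _ _
    rw [Metric.thickening_singleton, Metric.mem_ball]
    exact hi.trans (hr i).1
  refine ⟨disjointed f, ?_, disjoint_disjointed f, ?_, ?_, ?_⟩
  · exact fun i => disjointedRec (fun t i ht => ht.diff Metric.isOpen_thickening.measurableSet)
      Metric.isOpen_thickening.measurableSet
  · exact fun i => disjointedRec (p := fun s => μ (frontier s) = 0)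
      (fun t i ht => measure_frontier_sdiff_eq_zero ht (hfr i)) (hfr i)
  · intro i x hx y hy
    have hx' := disjointed_le f i hx
    have hy' := disjointed_le f i hy
    simp only [hf, Metric.thickening_singleton, Metric.mem_ball] at hx' hy'
    linarith [dist_triangle_right x y (TopologicalSpace.denseSeq M i), (hr i).2]
  · rw [← measure_iUnion (disjoint_disjointed f)
      (fun i => disjointedRec (fun t i ht => ht.diff Metric.isOpen_thickening.measurableSet)
        Metric.isOpen_thickening.measurableSet), ← Set.iSup_eq_iUnion, iSup_disjointed,
      Set.iSup_eq_iUnion, hcover, measure_univ]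

end Weak

lemma cost_le_add {M : Type*} [MetricSpace M] {C : ℝ≥0 → ℝ≥0} {c : M → M → ℝ≥0}
    (hCmono : Monotone C) (hc : ∀ x y, c x y = C (nndist x y)) (a x y : M) :
    c x y ≤ C (2 * nndist x a) + C (2 * nndist y a) := by
  have h := nndist_triangle_right x y a
  rw [hc]
  rcases le_total (nndist x a) (nndist y a) with hxy | hxy
  · refine (hCmono (h.trans ?_)).trans le_add_self
    rw [two_mul]; gcongr
  · refine (hCmono (h.trans ?_)).trans le_self_add
    rw [two_mul]; gcongr

/-! ### The convergence implications. -/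

section Transport

variable {M : Type*} [MetricSpace M] [MeasurableSpace M] [BorelSpace M]
  {C : ℝ≥0 → ℝ≥0} {c : M → M → ℝ≥0}

theorem tendsto_transportDist_of_tendsto [TopologicalSpace.SeparableSpace M]
    {μs : ℕ → ProbabilityMeasure M} {μ : ProbabilityMeasure M}
    (hCmono : Monotone C) (hCcont : Continuous C) (hC0 : C 0 = 0)
    (hc : ∀ x y, c x y = C (nndist x y)) {a : M}
    (hμ : doubleMoment C a (μ : Measure M) < ∞) (hweak : Tendsto μs atTop (𝓝 μ))
    (hmom : Tendsto (fun n => doubleMoment C a (μs n : Measure M)) atTop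
      (𝓝 (doubleMoment C a (μ : Measure M)))) :
    Tendsto (fun n => transportDist c (μs n : Measure M) (μ : Measure M)) atTop (𝓝 0) := by
  set g : M → ℝ≥0 := fun x => C (2 * nndist x a) with hg_def
  have hg : Continuous g := by fun_prop
  rw [ENNReal.tendsto_nhds_zero]
  intro δ hδ
  have hδ3 : 0 < δ / 3 := ENNReal.div_pos hδ.ne' (by simp)
  obtain ⟨R, hR⟩ : ∃ R : ℕ,
      ∫⁻ x, ((g x - R : ℝ≥0) : ℝ≥0∞) ∂(μ : Measure M) +
        ∫⁻ x, ((g x - R : ℝ≥0) : ℝ≥0∞) ∂(μ : Measure M) < δ / 3 := by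
    have := tendsto_lintegral_tsub_atTop (μ : Measure M) hg.measurable hμ.ne
    have := this.add this
    rw [add_zero] at this
    exact (this.eventually_lt_const hδ3).exists
  obtain ⟨η, hη, hCη⟩ : ∃ η : ℝ≥0, 0 < η ∧ (C η : ℝ≥0∞) < δ / 3 := by
    have h1 : Tendsto (fun t : ℝ≥0 => (C t : ℝ≥0∞)) (𝓝 0) (𝓝 0) := by
      have := (ENNReal.continuous_coe.comp hCcont).tendsto 0
      simpa only [Function.comp_def, hC0, ENNReal.coe_zero] using this
    have h2 : ∀ᶠ t in 𝓝[>] (0 : ℝ≥0), (C t : ℝ≥0∞) < δ / 3 :=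
      nhdsWithin_le_nhds (h1.eventually_lt_const hδ3)
    obtain ⟨t, ht, ht0⟩ := (h2.and self_mem_nhdsWithin).exists
    exact ⟨t, ht0, ht⟩
  obtain ⟨B, hB, hd, hfr, hdiam, hsum⟩ :=
    exists_continuity_partition (μ : Measure M) (NNReal.coe_pos.2 hη)
  have hcB : ∀ i, ∀ x ∈ B i, ∀ y ∈ B i, c x y ≤ C η := fun i x hx y hy => by
    rw [hc]
    exact hCmono (hdiam i x hx y hy).le
  have hR2 : (2 * (R : ℝ≥0∞)) ≠ ∞ := by finiteness
  obtain ⟨k, hk⟩ : ∃ k : ℕ,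
      2 * (R : ℝ≥0∞) * (1 - ∑ i ∈ Finset.range k, (μ : Measure M) (B i)) < δ / 3 := by
    have h1 : Tendsto (fun k => ∑ i ∈ Finset.range k, (μ : Measure M) (B i)) atTop (𝓝 1) :=
      hsum ▸ ENNReal.summable.hasSum.tendsto_sum_nat
    have h2 := ENNReal.Tendsto.const_mul (a := 2 * (R : ℝ≥0∞))
      (ENNReal.Tendsto.sub (tendsto_const_nhds (x := (1 : ℝ≥0∞))) h1 (.inl ENNReal.one_ne_top))
      (.inr hR2)
    rw [tsub_self, mul_zero] at h2
    exact (h2.eventually_lt_const hδ3).exists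
  -- With `R`, `η`, `k` fixed, the block bound converges as `n → ∞`; in the limit the minima become
  -- `μ (B i)`.
  have hlim : Tendsto (fun n => (C η : ℝ≥0∞) + 2 * ((R : ℝ≥0) : ℝ≥0∞) *
      (1 - ∑ i ∈ Finset.range k, min ((μs n : Measure M) (B i)) ((μ : Measure M) (B i))) +
      (∫⁻ x, ((g x - R : ℝ≥0) : ℝ≥0∞) ∂(μs n : Measure M) +
        ∫⁻ x, ((g x - R : ℝ≥0) : ℝ≥0∞) ∂(μ : Measure M))) atTop
      (𝓝 ((C η : ℝ≥0∞) + 2 * ((R : ℝ≥0) : ℝ≥0∞) *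
        (1 - ∑ i ∈ Finset.range k, min ((μ : Measure M) (B i)) ((μ : Measure M) (B i))) +
        (∫⁻ x, ((g x - R : ℝ≥0) : ℝ≥0∞) ∂(μ : Measure M) +
          ∫⁻ x, ((g x - R : ℝ≥0) : ℝ≥0∞) ∂(μ : Measure M)))) := by
    refine ((tendsto_const_nhds).add (ENNReal.Tendsto.const_mul
      (ENNReal.Tendsto.sub tendsto_const_nhds ?_ (.inl ENNReal.one_ne_top))
      (.inr (by simpa using hR2)))).add
      ((tendsto_lintegral_tsub hweak hg hmom R).add tendsto_const_nhds)
    exact tendsto_finsetSum _ fun i _ =>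
      (ProbabilityMeasure.tendsto_measure_of_null_frontier_of_tendsto' hweak (hfr i)).min
        tendsto_const_nhds
  have hlt : (C η : ℝ≥0∞) + 2 * ((R : ℝ≥0) : ℝ≥0∞) *
      (1 - ∑ i ∈ Finset.range k, min ((μ : Measure M) (B i)) ((μ : Measure M) (B i))) +
      (∫⁻ x, ((g x - R : ℝ≥0) : ℝ≥0∞) ∂(μ : Measure M) +
        ∫⁻ x, ((g x - R : ℝ≥0) : ℝ≥0∞) ∂(μ : Measure M)) < δ := by
    simp only [min_self, ENNReal.coe_natCast]
    calc _ < δ / 3 + δ / 3 + δ / 3 := ENNReal.add_lt_add (ENNReal.add_lt_add hCη hk) hR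
      _ = δ := ENNReal.add_thirds δ
  filter_upwards [hlim.eventually_lt_const hlt] with n hn
  exact (transportDist_le_of_blocks hg.measurable (cost_le_add hCmono hc a) hB hd k hcB R).trans
    hn.le

/-- Under any coupling, a point starting in `F` either lands in the `η`-thickening or pays at least
`C η`, and Markov's inequality bounds the latter event. -/
lemma measure_le_measure_thickening_add [SecondCountableTopology M]
    (hCmono : Monotone C) (hc : ∀ x y, c x y = C (nndist x y))
    {μ ν : Measure M} {F : Set M} (hF : MeasurableSet F) {η : ℝ≥0} (hη : 0 < C η) :
    μ F ≤ ν (Metric.thickening η F) + transportDist c μ ν / C η := by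
  have hCη : (C η : ℝ≥0∞) ≠ 0 := by exact_mod_cast hη.ne'
  -- Isolating the infimum reduces the claim to a single coupling.
  rw [← tsub_le_iff_left, ENNReal.le_div_iff_mul_le (.inl hCη) (.inl ENNReal.coe_ne_top)]
  refine le_iInf₂ fun π hπ => ?_
  rw [← ENNReal.le_div_iff_mul_le (.inl hCη) (.inl ENNReal.coe_ne_top), tsub_le_iff_left]
  have hmk : π {p : M × M | (C η : ℝ≥0∞) ≤ c p.1 p.2} ≤
      (∫⁻ p, (c p.1 p.2 : ℝ≥0∞) ∂π) / C η := by
    refine meas_ge_le_lintegral_div ?_ hCη ENNReal.coe_ne_top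
    simp_rw [hc]
    have := hCmono.measurable
    fun_prop
  rw [← hπ.1, ← hπ.2, Measure.map_apply measurable_fst hF,
    Measure.map_apply measurable_snd Metric.isOpen_thickening.measurableSet]
  refine (measure_mono fun p hp => ?_).trans ((measure_union_le _ _).trans
    (add_le_add_right hmk _))
  by_cases h : dist p.1 p.2 < η
  · left
    exact Metric.mem_thickening_iff.2 ⟨p.1, hp, by rwa [dist_comm]⟩
  · right
    change (C η : ℝ≥0∞) ≤ c p.1 p.2
    rw [hc]
    exact ENNReal.coe_le_coe.2 (hCmono (not_lt.1 h))

theorem tendsto_of_tendsto_transportDist [SecondCountableTopology M]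
    {μs : ℕ → ProbabilityMeasure M} {μ : ProbabilityMeasure M}
    (hCmono : Monotone C) (hc : ∀ x y, c x y = C (nndist x y)) (hpos : ∀ t, 0 < t → 0 < C t)
    (h : Tendsto (fun n => transportDist c (μs n : Measure M) (μ : Measure M)) atTop (𝓝 0)) :
    Tendsto μs atTop (𝓝 μ) := by
  refine tendsto_of_forall_isClosed_limsup_le' fun F hF => ?_
  have hthick : Tendsto (fun η => (μ : Measure M) (Metric.thickening η F)) (𝓝[>] 0)
      (𝓝 ((μ : Measure M) F)) :=
    tendsto_measure_thickening_of_isClosed ⟨1, one_pos, measure_ne_top _ _⟩ hF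
  refine ge_of_tendsto hthick ?_
  filter_upwards [self_mem_nhdsWithin] with η hη
  lift η to ℝ≥0 using (le_of_lt hη)
  have hCη := hpos η (by exact_mod_cast hη)
  have hlim : Tendsto (fun n => (μ : Measure M) (Metric.thickening η F) +
      transportDist c (μs n : Measure M) (μ : Measure M) / C η) atTop
      (𝓝 ((μ : Measure M) (Metric.thickening η F) + 0 / C η)) :=
    tendsto_const_nhds.add (ENNReal.Tendsto.div_const h
      (.inr (by exact_mod_cast hCη.ne')))
  rw [ENNReal.zero_div, add_zero] at hlim
  rw [← hlim.limsup_eq]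
  exact limsup_le_limsup (.of_forall fun n =>
    measure_le_measure_thickening_add hCmono hc hF.measurableSet hCη)

/-- A zero at `t > 0` would propagate to every `2 ^ k * t`, and monotonicity would force `C = 0`. -/
lemma pos_of_doubling (hCmono : Monotone C) (hne : ∃ t, C t ≠ 0) {l : ℝ≥0}
    (hl : ∀ y, C (2 * y) ≤ l * C y) (t : ℝ≥0) (ht : 0 < t) : 0 < C t := by
  by_contra h0
  obtain ⟨s, hs⟩ := hne
  have hz : ∀ k : ℕ, C (2 ^ k * t) = 0 := by
    intro k
    induction k with
    | zero => simpa using h0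
    | succ k ih =>
      have := hl (2 ^ k * t)
      rw [ih, mul_zero, ← mul_assoc, ← pow_succ'] at this
      exact le_antisymm this zero_le
  obtain ⟨k, hk⟩ := pow_unbounded_of_one_lt (s / t) (one_lt_two (α := ℝ≥0))
  have : s ≤ 2 ^ k * t := (div_le_iff₀ ht).1 hk.le
  exact hs (le_antisymm ((hCmono this).trans (hz k).le) zero_le)

omit [BorelSpace M] in
lemma doubleMoment_lt_top_of_doubling (hCmono : Monotone C) {l : ℝ≥0}
    (hl : ∀ y, C (2 * y) ≤ l * C y) (a b : M) {μ : Measure M} [IsFiniteMeasure μ]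
    (h : doubleMoment C a μ < ∞) : doubleMoment C b μ < ∞ := by
  have hle : ∀ x, C (2 * nndist x b) ≤ l * C (2 * nndist x a) + l * C (2 * nndist a b) := by
    intro x
    have htri := nndist_triangle x a b
    rcases le_total (nndist x a) (nndist a b) with hx | hx
    · refine ((hCmono ?_).trans (hl _)).trans le_add_self
      gcongr
      rw [two_mul]
      exact htri.trans (by gcongr)
    · refine ((hCmono ?_).trans (hl _)).trans le_self_add
      gcongr
      rw [two_mul]
      exact htri.trans (by gcongr)
  calc doubleMoment C b μ
      ≤ ∫⁻ x, ((l : ℝ≥0∞) * C (2 * nndist x a) + l * C (2 * nndist a b)) ∂μ :=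
        lintegral_mono fun x => by
          simp only [← ENNReal.coe_mul, ← ENNReal.coe_add]
          exact ENNReal.coe_le_coe.2 (hle x)
    _ = l * doubleMoment C a μ + l * C (2 * nndist a b) * μ Set.univ := by
        rw [lintegral_add_right _ measurable_const, lintegral_const,
          lintegral_const_mul' _ _ ENNReal.coe_ne_top, doubleMoment]
    _ < ∞ := by finiteness

/-- If `d(x, y) ≤ d(y, b)`, then `d(x, b) ≤ 2 d(y, b)` and one doubling suffices; otherwise `2 d(x,
b) ≤ 4 d(x, y)`, and two doublings produce `l ^ 2`. -/
lemma lintegral_tsub_le_of_doubling (hCmono : Monotone C)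
    (hc : ∀ x y, c x y = C (nndist x y)) {l : ℝ≥0} (hl0 : 0 < l)
    (hl : ∀ y, C (2 * y) ≤ l * C y) (b : M)
    (μ ν : Measure M) (R : ℝ≥0) :
    ∫⁻ x, ((C (2 * nndist x b) - l * R : ℝ≥0) : ℝ≥0∞) ∂μ ≤
      l ^ 2 * transportDist c μ ν + l * ∫⁻ y, ((C (2 * nndist y b) - R : ℝ≥0) : ℝ≥0∞) ∂ν := by
  have hle : ∀ x y, C (2 * nndist x b) - l * R ≤
      l ^ 2 * c x y + l * (C (2 * nndist y b) - R) := by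
    intro x y
    have htri := nndist_triangle x y b
    rcases le_total (nndist x y) (nndist y b) with hx | hx
    · refine le_trans ?_ le_add_self
      rw [mul_tsub]
      gcongr
      refine (hCmono ?_).trans (hl _)
      gcongr
      rw [two_mul]
      exact htri.trans (by gcongr)
    · refine tsub_le_self.trans (le_trans ?_ le_self_add)
      rw [hc, pow_two, mul_assoc]
      refine le_trans ((hCmono ?_).trans (hl _)) (by gcongr; exact hl _)
      gcongr
      rw [two_mul]
      exact htri.trans (by gcongr)
  have hl2 : ((l : ℝ≥0∞) ^ 2) ≠ 0 := by positivity
  have hl2' : ((l : ℝ≥0∞) ^ 2) ≠ ∞ := by finiteness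
  have hCm := hCmono.measurable
  rw [← tsub_le_iff_right, ← ENNReal.div_le_iff' hl2 hl2']
  refine le_iInf₂ fun π hπ => ?_
  rw [ENNReal.div_le_iff' hl2 hl2', tsub_le_iff_right, ← hπ.1, ← hπ.2,
    lintegral_map (by fun_prop) measurable_fst,
    lintegral_map (by fun_prop) measurable_snd, ← lintegral_const_mul' _ _ hl2',
    ← lintegral_const_mul' _ _ ENNReal.coe_ne_top, ← lintegral_add_right _ (by fun_prop)]
  refine lintegral_mono fun p => ?_
  simp only [← ENNReal.coe_mul, ← ENNReal.coe_add, ← ENNReal.coe_pow]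
  exact ENNReal.coe_le_coe.2 (hle p.1 p.2)

theorem tendsto_doubleMoment_of_tendsto_transportDist [SecondCountableTopology M]
    {μs : ℕ → ProbabilityMeasure M} {μ : ProbabilityMeasure M}
    (hCmono : Monotone C) (hCcont : Continuous C) (hc : ∀ x y, c x y = C (nndist x y))
    {l : ℝ≥0} (hl0 : 0 < l) (hl : ∀ y, C (2 * y) ≤ l * C y) {b : M}
    (hμ : doubleMoment C b (μ : Measure M) < ∞) (hweak : Tendsto μs atTop (𝓝 μ))
    (h : Tendsto (fun n => transportDist c (μs n : Measure M) (μ : Measure M)) atTop (𝓝 0)) :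
    Tendsto (fun n => doubleMoment C b (μs n : Measure M)) atTop
      (𝓝 (doubleMoment C b (μ : Measure M))) := by
  set g : M → ℝ≥0 := fun x => C (2 * nndist x b) with hg_def
  have hg : Continuous g := by fun_prop
  have htail := tendsto_lintegral_tsub_atTop (μ : Measure M) hg.measurable hμ.ne
  have hsplit : ∀ (ν : Measure M) (R : ℝ≥0), doubleMoment C b ν =
      ∫⁻ x, ((min (g x) R : ℝ≥0) : ℝ≥0∞) ∂ν + ∫⁻ x, ((g x - R : ℝ≥0) : ℝ≥0∞) ∂ν :=
    fun ν R => (lintegral_min_add_lintegral_tsub ν hg.measurable R).symm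
  refine tendsto_of_le_liminf_of_limsup_le ?_ ?_
  -- Lower bound: truncated moments converge weakly, and the tail of `μ` vanishes as `R → ∞`.
  · have hR : Tendsto (fun R : ℕ =>
        liminf (fun n => doubleMoment C b (μs n : Measure M)) atTop +
          ∫⁻ x, ((g x - R : ℝ≥0) : ℝ≥0∞) ∂(μ : Measure M)) atTop
        (𝓝 (liminf (fun n => doubleMoment C b (μs n : Measure M)) atTop + 0)) :=
      tendsto_const_nhds.add htail
    rw [add_zero] at hR
    refine ge_of_tendsto' hR fun R => ?_
    rw [hsplit μ R]
    gcongr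
    rw [← (tendsto_lintegral_min hweak hg R).liminf_eq]
    refine liminf_le_liminf (.of_forall fun n => ?_)
    exact lintegral_mono fun x => ENNReal.coe_le_coe.2 (min_le_left _ _)
  -- Upper bound: truncate at `l * R`, the level at which the tail of `μs n` is controlled by `T_c`
  -- and the tail of `μ` at `R`.
  · have hR : Tendsto (fun R : ℕ => doubleMoment C b (μ : Measure M) +
          l * ∫⁻ x, ((g x - R : ℝ≥0) : ℝ≥0∞) ∂(μ : Measure M)) atTop
        (𝓝 (doubleMoment C b (μ : Measure M) + l * 0)) :=
      tendsto_const_nhds.add (ENNReal.Tendsto.const_mul htail (.inr ENNReal.coe_ne_top))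
    rw [mul_zero, add_zero] at hR
    refine ge_of_tendsto' hR fun R => ?_
    have hlim := ((tendsto_lintegral_min hweak hg (l * R)).add
      ((ENNReal.Tendsto.const_mul (a := (l : ℝ≥0∞) ^ 2) h (.inr (by finiteness))).add_const
        (l * ∫⁻ x, ((g x - R : ℝ≥0) : ℝ≥0∞) ∂(μ : Measure M))))
    rw [mul_zero, zero_add] at hlim
    refine (limsup_le_limsup (.of_forall fun n => ?_)).trans (hlim.limsup_eq.trans_le ?_)
    · rw [hsplit (μs n) (l * R)]
      exact add_le_add_right (lintegral_tsub_le_of_doubling hCmono hc hl0 hl b _ _ R) _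
    · gcongr
      exact lintegral_mono fun x => ENNReal.coe_le_coe.2 (min_le_left _ _)

end Transport

theorem theorem2 {M : Type*} [MetricSpace M] [CompleteSpace M] [TopologicalSpace.SeparableSpace M]
    [MeasurableSpace M] [BorelSpace M]
    (μs : ℕ → ProbabilityMeasure M) (μ : ProbabilityMeasure M)
    (C : ℝ≥0 → ℝ≥0) (hCmono : Monotone C) (hCcont : Continuous C) (hC0 : C 0 = 0)
    (c : M → M → ℝ≥0) (hc : ∀ x y, c x y = C (nndist x y))
    (a : M) (hμs : ∀ n, doubleMoment C a (μs n : Measure M) < ∞)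
    (hμ : doubleMoment C a (μ : Measure M) < ∞) :
    -- weak convergence and convergence of the moments imply convergence in `T_c`
    ((Tendsto μs atTop (𝓝 μ) ∧
        Tendsto (fun n => doubleMoment C a (μs n : Measure M)) atTop
          (𝓝 (doubleMoment C a (μ : Measure M)))) →
      Tendsto (fun n => transportDist c (μs n : Measure M) (μ : Measure M)) atTop (𝓝 0)) ∧
    -- conversely, convergence in `T_c` implies weak convergence
    ((∀ t, 0 < t → 0 < C t) →
      Tendsto (fun n => transportDist c (μs n : Measure M) (μ : Measure M)) atTop (𝓝 0) →
      Tendsto μs atTop (𝓝 μ)) ∧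
    -- under the doubling condition, the moments are finite around every point, and
    -- the equivalence holds with every choice of the base point
    ((∃ t, C t ≠ 0) → (∃ l : ℝ≥0, 0 < l ∧ ∀ y, C (2 * y) ≤ l * C y) →
      ∀ b : M,
        (∀ n, doubleMoment C b (μs n : Measure M) < ∞) ∧
        doubleMoment C b (μ : Measure M) < ∞ ∧
        (Tendsto (fun n => transportDist c (μs n : Measure M) (μ : Measure M)) atTop (𝓝 0) ↔
          (Tendsto μs atTop (𝓝 μ) ∧
            Tendsto (fun n => doubleMoment C b (μs n : Measure M)) atTop
              (𝓝 (doubleMoment C b (μ : Measure M)))))) := by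
  have : SecondCountableTopology M := UniformSpace.secondCountable_of_separable M
  refine ⟨fun h => tendsto_transportDist_of_tendsto hCmono hCcont hC0 hc hμ h.1 h.2,
    fun hpos h => tendsto_of_tendsto_transportDist hCmono hc hpos h, ?_⟩
  rintro hne ⟨l, hl0, hl⟩ b
  have hμb := doubleMoment_lt_top_of_doubling hCmono hl a b hμ
  refine ⟨fun n => doubleMoment_lt_top_of_doubling hCmono hl a b (hμs n), hμb,
    fun h => ?_, fun h => tendsto_transportDist_of_tendsto hCmono hCcont hC0 hc hμb h.1 h.2⟩
  have hweak := tendsto_of_tendsto_transportDist hCmono hc (pos_of_doubling hCmono hne hl) h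
  exact ⟨hweak, tendsto_doubleMoment_of_tendsto_transportDist hCmono hCcont hc hl0 hl hμb hweak h⟩
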